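/- Let $2 \le k \le n/2$. The Johnson graph $J(n,k)$ has as vertices the $k$-element subsets of $[n]=\{1,\dots,n\}$, two of them being adjacent when they share exactly $k-1$ elements; write $V=\binom{[n]}{k}$. For $1\le t\le k$ let $\Phi_t$ be any orthonormal basis of the eigenspace of the graph Laplacian of $J(n,k)$ for the eigenvalue $\lambda_t=t(n+1-t)$, and let $\Phi_{[k]\setminus[1]}=\Phi_2\cup\dots\cup\Phi_k$. A nonempty set $\mathcal D\subseteq V$ is a $\Phi_{[k]\setminus[1]}$-design if $$\frac1{|\mathcal D|}\sum_{v\in\mathcal D}\phi(v)=\frac1{|V|}\sum_{v\in V}\phi(v)\qquad\text{for all }\phi\in\Phi_{[k]\setminus[1]},$$ and it is minimal if no other $\Phi_{[k]\setminus[1]}$-design is contained in it. For $i\in[n]$ let $\mathcal D_i\subseteq V$ be the set of all $k$-element subsets of $[n]$ containing $i$. Then the minimal $\Phi_{[k]\setminus[1]}$-designs are exactly the sets $\mathcal D_i$ and their complements $V\setminus\mathcal D_i$, $i\in[n]$, and every $\Phi_{[k]\setminus[1]}$-design is a union of sets of these two kinds. -/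

import Mathlib

/-- The `k`-element subsets of `[n]`, with `[n]` modelled as `Fin n`. -/
abbrev KSubset (n k : ℕ) : Type := {S : Finset (Fin n) // S.card = k}

/-- The Johnson graph `J(n,k)`: two `k`-sets are adjacent when they share exactly `k - 1`
elements. -/
def johnsonGraph (n k : ℕ) : SimpleGraph (KSubset n k) where
  Adj S T := (S.1 ∩ T.1).card + 1 = k
  symm := ⟨fun S T h => by rwa [Finset.inter_comm]⟩
  loopless := ⟨fun S h => by
    rw [Finset.inter_self, S.2] at h
    omega⟩

instance (n k : ℕ) : DecidableRel (johnsonGraph n k).Adj :=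
  fun S T => inferInstanceAs (Decidable ((S.1 ∩ T.1).card + 1 = k))

/-- The eigenspace, for the eigenvalue `μ`, of the Laplacian (degree matrix minus adjacency
matrix) of a finite graph, acting on real functions on the vertices. -/
noncomputable def laplacianEigenspace {V : Type*} [Fintype V] [DecidableEq V]
    (G : SimpleGraph V) [DecidableRel G.Adj] (μ : ℝ) : Submodule ℝ (EuclideanSpace ℝ V) :=
  Module.End.eigenspace (Matrix.toEuclideanLin (G.lapMatrix ℝ)) μ

/-- The set `B` is an orthonormal basis of the subspace `W`. -/
def IsOrthonormalBasisOf {V : Type*} [Fintype V]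
    (B : Set (EuclideanSpace ℝ V)) (W : Submodule ℝ (EuclideanSpace ℝ V)) : Prop :=
  Orthonormal ℝ (fun φ : B => (φ : EuclideanSpace ℝ V)) ∧ Submodule.span ℝ B = W

/-- The Laplacian eigenvalue `λ_t = t (n + 1 - t)` of `J(n,k)`. -/
def johnsonEigenvalue (n t : ℕ) : ℝ := (t : ℝ) * ((n : ℝ) + 1 - (t : ℝ))

/-- `D` averages `φ`: the mean of `φ` over `D` is its mean over all vertices. -/
def Averages {V : Type*} [Fintype V] (D : Finset V) (φ : EuclideanSpace ℝ V) : Prop :=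
  (1 / (D.card : ℝ)) * ∑ v ∈ D, φ v = (1 / (Fintype.card V : ℝ)) * ∑ v, φ v

/-- `D` is a `Φ`-design: a nonempty vertex set averaging every member of `Φ`. -/
def IsDesign {V : Type*} [Fintype V] (Φ : Set (EuclideanSpace ℝ V)) (D : Finset V) : Prop :=
  D.Nonempty ∧ ∀ φ ∈ Φ, Averages D φ

/-- A `Φ`-design that contains no other `Φ`-design. -/
def IsMinimalDesign {V : Type*} [Fintype V] (Φ : Set (EuclideanSpace ℝ V))
    (D : Finset V) : Prop :=
  IsDesign Φ D ∧ ∀ D' : Finset V, IsDesign Φ D' → D' ⊆ D → D' = D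

/-- The union `Φ_S` of the sets `Φ_t` with `t ∈ S`. -/
def unionOver {X : Type*} (Φ : ℕ → Set X) (S : Finset ℕ) : Set X := ⋃ t ∈ S, Φ t

/-- The star `D_i`: all `k`-subsets of `[n]` that contain `i`. -/
def johnsonStar (n k : ℕ) (i : Fin n) : Finset (KSubset n k) :=
  Finset.univ.filter (fun S => i ∈ S.1)

/-! A design is a set whose indicator is orthogonal to the eigenspaces of index 2 to k. On monomials
x_A the Laplacian L is triangular: L x_A is λ_{|A|} x_A plus multiples of the x_{A∖c}
(`johnsonLaplacian_sliceMonomial`), so L - λ_d lowers degree d to d - 1. As L is symmetric, each L -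
λ_t with 2 ≤ t ≤ k is bijective on the orthogonal complement of those eigenspaces. Hence every f
there is (L - λ_2)⋯(L - λ_k)h, and since h has degree at most k, f has degree at most 1
(`mem_sliceDegreeLE_one`). A 0/1-valued affine function on the slice is a constant, a coordinate or
a negated coordinate (`boolean_affine_slice`). Conversely, symmetry of L makes these eigenfunctions
orthogonal to every x_∅ and x_{i}. So the designs are V, the stars and their complements; only V is
not minimal. -/

/-! ### Neighbour sums and swaps. -/

open Finset in
/-- Summing over the neighbours of `S` in the Johnson graph is summing over all swaps. -/
theorem sum_johnsonGraph_neighborFinset {n k : ℕ} (S : KSubset n k)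
    (g : Finset (Fin n) → ℝ) :
    ∑ T ∈ (johnsonGraph n k).neighborFinset S, g T.1 =
      ∑ a ∈ S.1, ∑ b ∈ S.1ᶜ, g (insert b (S.1.erase a)) := by
  obtain ⟨S, hS⟩ := S
  have himg : ((johnsonGraph n k).neighborFinset ⟨S, hS⟩).map (Function.Embedding.subtype _) =
      (S ×ˢ Sᶜ).image (fun p => insert p.2 (S.erase p.1)) := by
    ext T
    simp only [mem_map, SimpleGraph.mem_neighborFinset, Function.Embedding.coe_subtype,
      mem_image, mem_product, mem_compl, Prod.exists]
    constructor
    · rintro ⟨⟨T, hT⟩, hadj, rfl⟩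
      change (S ∩ T).card + 1 = k at hadj
      have h1 : (S \ T).card = 1 := by
        have := card_inter_add_card_sdiff S T
        omega
      have h2 : (T \ S).card = 1 := by
        have := card_inter_add_card_sdiff T S
        rw [inter_comm] at this
        omega
      obtain ⟨a, ha⟩ := card_eq_one.1 h1
      obtain ⟨b, hb⟩ := card_eq_one.1 h2
      have ha' : ∀ x, (x ∈ S ∧ x ∉ T) ↔ x = a := fun x => by
        rw [← mem_sdiff, ha, mem_singleton]
      have hb' : ∀ x, (x ∈ T ∧ x ∉ S) ↔ x = b := fun x => by
        rw [← mem_sdiff, hb, mem_singleton]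
      refine ⟨a, b, ⟨((ha' a).2 rfl).1, ((hb' b).2 rfl).2⟩, ?_⟩
      ext x
      simp only [mem_insert, mem_erase]
      have := ha' x
      have := hb' x
      tauto
    · rintro ⟨a, b, ⟨ha, hb⟩, rfl⟩
      have hb' : b ∉ S.erase a := fun h => hb (mem_of_mem_erase h)
      have hc : (S.erase a).card + 1 = k := by rw [card_erase_add_one ha, hS]
      refine ⟨⟨insert b (S.erase a), by rw [card_insert_of_notMem hb', hc]⟩, ?_, rfl⟩
      change (S ∩ insert b (S.erase a)).card + 1 = k
      rw [inter_insert_of_notMem hb, inter_eq_right.2 (erase_subset a S), hc]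
  have hsum : ∑ T ∈ (johnsonGraph n k).neighborFinset ⟨S, hS⟩, g T.1 =
      ∑ T ∈ ((johnsonGraph n k).neighborFinset ⟨S, hS⟩).map (Function.Embedding.subtype _),
        g T := by
    rw [sum_map]
    rfl
  rw [hsum, himg, sum_image, sum_product]
  rintro ⟨a, b⟩ hp ⟨a', b'⟩ hp' heq
  simp only [coe_product, Set.mem_prod, mem_coe, mem_compl] at hp hp' heq
  have key : ∀ x, (x = b ∨ x ≠ a ∧ x ∈ S) ↔ (x = b' ∨ x ≠ a' ∧ x ∈ S) := fun x => by
    simpa only [mem_insert, mem_erase] using Finset.ext_iff.1 heq x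
  have e1 : b = b' := by
    by_contra h
    have := key b
    tauto
  have e2 : a = a' := by
    by_contra h
    have := key a
    have hab : a ≠ b := fun h => hp.2 (h ▸ hp.1)
    have hab' : a ≠ b' := fun h => hp'.2 (h ▸ hp.1)
    tauto
  rw [e1, e2]

/-- The monomial `x_A` on the slice: the indicator of the `k`-sets containing `A`. -/
noncomputable def sliceMonomial (n k : ℕ) (A : Finset (Fin n)) :
    EuclideanSpace ℝ (KSubset n k) :=
  WithLp.toLp 2 fun S => if A ⊆ S.1 then 1 else 0

theorem sliceMonomial_apply {n k : ℕ} (A : Finset (Fin n)) (S : KSubset n k) :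
    sliceMonomial n k A S = if A ⊆ S.1 then 1 else 0 := rfl

open Finset in
/-- The number of swaps of `S` that contain `A`. -/
theorem sum_swap_subset {n : ℕ} (S A : Finset (Fin n)) :
    ∑ a ∈ S, ∑ b ∈ Sᶜ, (if A ⊆ insert b (S.erase a) then (1 : ℝ) else 0) =
      ((S.card : ℝ) - A.card) * ((n : ℝ) - S.card) * (if A ⊆ S then 1 else 0) +
      ((S.card : ℝ) - A.card + 1) * ((∑ c ∈ A, if A.erase c ⊆ S then (1 : ℝ) else 0) -
        A.card * (if A ⊆ S then 1 else 0)) := by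
  -- The removed point must avoid A, and A may leave S only at the added point; the double sum thus
  -- factors.
  have hiff : ∀ a ∈ S, ∀ b ∈ Sᶜ, (A ⊆ insert b (S.erase a) ↔ a ∉ A ∧ A.erase b ⊆ S) := by
    intro a ha b hb
    have hab : a ≠ b := by
      rintro rfl
      exact mem_compl.1 hb ha
    rw [subset_insert_iff, subset_erase, mem_erase]
    tauto
  have h1 : ∑ a ∈ S, ∑ b ∈ Sᶜ, (if A ⊆ insert b (S.erase a) then (1 : ℝ) else 0) =
      ((S \ A).card : ℝ) * ∑ b ∈ Sᶜ, if A.erase b ⊆ S then (1 : ℝ) else 0 := by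
    have : ((S \ A).card : ℝ) = ∑ a ∈ S, if a ∉ A then (1 : ℝ) else 0 := by
      rw [sum_boole, sdiff_eq_filter]
    rw [this, sum_mul]
    refine sum_congr rfl fun a ha => ?_
    rw [mul_sum]
    refine sum_congr rfl fun b hb => ?_
    rw [if_congr (hiff a ha b hb) rfl rfl, ite_and, ite_mul, one_mul, zero_mul]
  rw [h1]
  by_cases hA : A ⊆ S
  · have h2 : ∀ b, A.erase b ⊆ S := fun b => (erase_subset b A).trans hA
    have h3 : ((S \ A).card : ℝ) = S.card - A.card := by
      rw [card_sdiff_of_subset hA, Nat.cast_sub (card_le_card hA)]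
    have h4 : ((Sᶜ.card : ℕ) : ℝ) = n - S.card := by
      rw [card_compl, Fintype.card_fin, Nat.cast_sub]
      simpa using card_le_univ S
    simp [h2, h3, h4, hA]
  · have h2 : ∑ b ∈ Sᶜ, (if A.erase b ⊆ S then (1 : ℝ) else 0) =
        ∑ b ∈ A \ S, if A.erase b ⊆ S then (1 : ℝ) else 0 := by
      symm
      refine sum_subset (fun x hx => by simp_all) fun x hx hx' => if_neg fun h => hA ?_
      rw [erase_eq_of_notMem] at h
      · exact h
      · simp_all
    have h3 : ∑ b ∈ A, (if A.erase b ⊆ S then (1 : ℝ) else 0) =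
        ∑ b ∈ A \ S, if A.erase b ⊆ S then (1 : ℝ) else 0 := by
      symm
      refine sum_subset sdiff_subset fun x hx hx' => if_neg fun h => hA ?_
      have hxS : x ∈ S := by simp_all
      rw [← insert_erase hx]
      exact insert_subset hxS h
    rw [h2, h3, if_neg hA, mul_zero, mul_zero, zero_add, sub_zero, mul_sum, mul_sum]
    refine sum_congr rfl fun b hb => ?_
    split_ifs with h
    -- Here A misses S only in b, so |S ∖ A| = |S| - |A| + 1.
    · obtain ⟨hbA, hbS⟩ := mem_sdiff.1 hb
      have h4 : S ∩ A = A.erase b := by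
        ext x
        have := @h x
        simp only [mem_inter, mem_erase] at this ⊢
        constructor
        · rintro ⟨h5, h6⟩
          exact ⟨fun h => hbS (h ▸ h5), h6⟩
        · exact fun h5 => ⟨this h5, h5.2⟩
      have h5 := card_inter_add_card_sdiff S A
      have h6 := card_erase_add_one hbA
      rw [h4] at h5
      rw [← h5, ← h6]
      push_cast
      ring
    · simp

/-! ### The Laplacian and the degree filtration. -/

/-- The Laplacian of the Johnson graph as a linear endomorphism. -/
noncomputable abbrev johnsonLaplacian (n k : ℕ) :
    Module.End ℝ (EuclideanSpace ℝ (KSubset n k)) :=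
  Matrix.toEuclideanLin ((johnsonGraph n k).lapMatrix ℝ)

theorem johnsonLaplacian_isSymmetric (n k : ℕ) : (johnsonLaplacian n k).IsSymmetric := by
  rw [johnsonLaplacian, Matrix.isSymmetric_toEuclideanLin_iff, Matrix.IsHermitian,
    Matrix.conjTranspose_eq_transpose_of_trivial]
  exact (johnsonGraph n k).isSymm_lapMatrix ℝ

theorem johnsonLaplacian_apply {n k : ℕ} (f : EuclideanSpace ℝ (KSubset n k))
    (S : KSubset n k) :
    johnsonLaplacian n k f S = (k * ((n : ℝ) - k)) * f S -
      ∑ T ∈ (johnsonGraph n k).neighborFinset S, f T := by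
  have hdeg : ((johnsonGraph n k).degree S : ℝ) = k * ((n : ℝ) - k) := by
    have h := sum_johnsonGraph_neighborFinset S fun _ => 1
    have hk : k ≤ n := by
      have := Finset.card_le_univ S.1
      rwa [S.2, Fintype.card_fin] at this
    simp only [Finset.sum_const, SimpleGraph.card_neighborFinset_eq_degree, S.2,
      Finset.card_compl, Fintype.card_fin, nsmul_eq_mul, mul_one, Nat.cast_sub hk] at h
    exact h
  rw [← hdeg]
  exact SimpleGraph.lapMatrix_mulVec_apply (R := ℝ) (G := johnsonGraph n k) S f.ofLp

/-- With d = |A|, the swap count leaves x_A the coefficient k(n-k) - (k-d)(n-k) + (k-d+1)d =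
d(n+1-d). -/
theorem johnsonLaplacian_sliceMonomial {n k : ℕ} (A : Finset (Fin n)) :
    johnsonLaplacian n k (sliceMonomial n k A) =
      johnsonEigenvalue n A.card • sliceMonomial n k A -
      ((k : ℝ) - A.card + 1) • ∑ c ∈ A, sliceMonomial n k (A.erase c) := by
  ext S
  rw [johnsonLaplacian_apply]
  simp only [sliceMonomial_apply]
  rw [sum_johnsonGraph_neighborFinset S fun T => if A ⊆ T then (1 : ℝ) else 0,
    sum_swap_subset, S.2]
  simp only [PiLp.sub_apply, PiLp.smul_apply, smul_eq_mul, WithLp.ofLp_sum, Finset.sum_apply,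
    sliceMonomial_apply, johnsonEigenvalue]
  ring

/-- The functions of degree at most `d` on the slice. -/
noncomputable def sliceDegreeLE (n k d : ℕ) : Submodule ℝ (EuclideanSpace ℝ (KSubset n k)) :=
  Submodule.span ℝ {f | ∃ A : Finset (Fin n), A.card ≤ d ∧ f = sliceMonomial n k A}

theorem sliceMonomial_mem_sliceDegreeLE {n k d : ℕ} {A : Finset (Fin n)} (hA : A.card ≤ d) :
    sliceMonomial n k A ∈ sliceDegreeLE n k d :=
  Submodule.subset_span ⟨A, hA, rfl⟩

theorem johnsonLaplacian_sub_mem {n k d : ℕ} {f : EuclideanSpace ℝ (KSubset n k)}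
    (hf : f ∈ sliceDegreeLE n k (d + 1)) :
    johnsonLaplacian n k f - johnsonEigenvalue n (d + 1) • f ∈ sliceDegreeLE n k d := by
  suffices h : sliceDegreeLE n k (d + 1) ≤ (sliceDegreeLE n k d).comap
      (johnsonLaplacian n k - johnsonEigenvalue n (d + 1) • LinearMap.id) from h hf
  refine Submodule.span_le.2 ?_
  rintro _ ⟨A, hA, rfl⟩
  have hsum : ∑ c ∈ A, sliceMonomial n k (A.erase c) ∈ sliceDegreeLE n k d :=
    Submodule.sum_mem _ fun c hc => sliceMonomial_mem_sliceDegreeLE (by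
      have := Finset.card_erase_add_one hc
      omega)
  simp only [Submodule.comap_coe, Set.mem_preimage, SetLike.mem_coe, LinearMap.sub_apply,
    LinearMap.smul_apply, LinearMap.id_apply]
  rw [johnsonLaplacian_sliceMonomial]
  rcases Nat.lt_or_ge d A.card with h | h
  · rw [show A.card = d + 1 by omega, sub_right_comm, sub_self, zero_sub]
    exact neg_mem (Submodule.smul_mem _ _ hsum)
  · have hx := sliceMonomial_mem_sliceDegreeLE (k := k) h
    exact sub_mem (sub_mem (Submodule.smul_mem _ _ hx) (Submodule.smul_mem _ _ hsum))
      (Submodule.smul_mem _ _ hx)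

theorem mem_sliceDegreeLE_self {n k : ℕ} (f : EuclideanSpace ℝ (KSubset n k)) :
    f ∈ sliceDegreeLE n k k := by
  have hf : f = ∑ S : KSubset n k, f S • sliceMonomial n k S.1 := by
    ext T
    simp only [WithLp.ofLp_sum, Finset.sum_apply, PiLp.smul_apply, smul_eq_mul,
      sliceMonomial_apply]
    rw [Finset.sum_eq_single T]
    · simp
    · intro S _ hST
      rw [if_neg, mul_zero]
      exact fun h => hST (Subtype.ext (Finset.eq_of_subset_of_card_le h (by rw [S.2, T.2])))
    · simp
  rw [hf]
  exact Submodule.sum_mem _ fun S _ =>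
    Submodule.smul_mem _ _ (sliceMonomial_mem_sliceDegreeLE S.2.le)

/-! ### Orthogonality to the higher eigenspaces forces degree one. -/

theorem mem_orthogonal_biSup_iff {E ι : Type*} [NormedAddCommGroup E] [InnerProductSpace ℝ E]
    {I : Set ι} {U : ι → Submodule ℝ E} {g : E} :
    g ∈ (⨆ t ∈ I, U t)ᗮ ↔ ∀ t ∈ I, ∀ φ ∈ U t, inner ℝ φ g = 0 := by
  simp_rw [← Submodule.mem_orthogonal, ← Submodule.iInf_orthogonal, Submodule.mem_iInf]
  refine forall_congr' fun t => ?_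
  by_cases ht : t ∈ I <;> simp [ht]

/-- For symmetric `T`, subtracting an eigenvalue `μ t₀` is onto on the orthogonal complement of a
family of eigenspaces that contains the one for `μ t₀`. -/
theorem LinearMap.IsSymmetric.exists_sub_smul_eq {E ι : Type*} [NormedAddCommGroup E]
    [InnerProductSpace ℝ E] [FiniteDimensional ℝ E] {T : Module.End ℝ E} (hT : T.IsSymmetric)
    (μ : ι → ℝ) (I : Set ι) {t₀ : ι} (ht₀ : t₀ ∈ I) {f : E}
    (hf : f ∈ (⨆ t ∈ I, Module.End.eigenspace T (μ t))ᗮ) :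
    ∃ h ∈ (⨆ t ∈ I, Module.End.eigenspace T (μ t))ᗮ, T h - μ t₀ • h = f := by
  set W := (⨆ t ∈ I, Module.End.eigenspace T (μ t))ᗮ
  have hmem : ∀ g, g ∈ W ↔ ∀ t ∈ I, ∀ φ ∈ Module.End.eigenspace T (μ t), inner ℝ φ g = 0 :=
    fun g => mem_orthogonal_biSup_iff
  set R : Module.End ℝ E := T - μ t₀ • LinearMap.id with hR
  have hmaps : ∀ g ∈ W, R g ∈ W := by
    intro g hg
    rw [hmem] at hg ⊢
    intro t ht φ hφ
    have h1 := hT φ g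
    rw [Module.End.mem_eigenspace_iff.1 hφ, inner_smul_left, hg t ht φ hφ, mul_zero] at h1
    simp only [hR, LinearMap.sub_apply, LinearMap.smul_apply, LinearMap.id_apply,
      inner_sub_right, inner_smul_right, hg t ht φ hφ, ← h1, mul_zero, sub_zero]
  -- A kernel vector lies in the eigenspace of `μ t₀` and is orthogonal to it.
  have hinj : Function.Injective (R.restrict hmaps) := by
    rw [← LinearMap.ker_eq_bot, LinearMap.ker_eq_bot']
    rintro ⟨g, hg⟩ h0
    have h1 : R g = 0 := congrArg Subtype.val h0
    have h2 : g ∈ Module.End.eigenspace T (μ t₀) := by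
      rw [Module.End.mem_eigenspace_iff]
      exact sub_eq_zero.1 h1
    exact Subtype.ext (inner_self_eq_zero.1 ((hmem g).1 hg t₀ ht₀ g h2))
  obtain ⟨⟨h, hh⟩, he⟩ := LinearMap.injective_iff_surjective.1 hinj ⟨f, hf⟩
  exact ⟨h, hh, congrArg Subtype.val he⟩

/-- A function orthogonal to the Johnson eigenspaces of index `2, …, k` has degree at most one. -/
theorem mem_sliceDegreeLE_one {n k : ℕ} (hk : 1 ≤ k) {f : EuclideanSpace ℝ (KSubset n k)}
    (hf : f ∈ (⨆ t ∈ Set.Icc 2 k,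
      Module.End.eigenspace (johnsonLaplacian n k) (johnsonEigenvalue n t))ᗮ) :
    f ∈ sliceDegreeLE n k 1 := by
  have key : ∀ j, j + 1 ≤ k → ∀ g ∈ (⨆ t ∈ Set.Icc 2 k,
      Module.End.eigenspace (johnsonLaplacian n k) (johnsonEigenvalue n t))ᗮ,
      g ∈ sliceDegreeLE n k (k - j) := by
    intro j
    induction j with
    | zero => exact fun _ g _ => mem_sliceDegreeLE_self g
    | succ j ih =>
      intro hj g hg
      have ht : k - j ∈ Set.Icc 2 k := ⟨by omega, by omega⟩
      obtain ⟨h, hh, rfl⟩ :=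
        (johnsonLaplacian_isSymmetric n k).exists_sub_smul_eq _ _ ht hg
      have h1 := ih (by omega) h hh
      rw [show k - j = k - (j + 1) + 1 by omega] at h1 ⊢
      exact johnsonLaplacian_sub_mem h1
  have := key (k - 1) (by omega) f hf
  rwa [show k - (k - 1) = 1 by omega] at this

theorem exists_affine_of_mem_sliceDegreeLE_one {n k : ℕ} {f : EuclideanSpace ℝ (KSubset n k)}
    (hf : f ∈ sliceDegreeLE n k 1) :
    ∃ (c : ℝ) (a : Fin n → ℝ), ∀ S, f S = c + ∑ i ∈ S.1, a i := by
  induction hf using Submodule.span_induction with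
  | mem x hx =>
    obtain ⟨A, hA, rfl⟩ := hx
    rcases Nat.le_one_iff_eq_zero_or_eq_one.1 hA with h | h
    · rw [Finset.card_eq_zero] at h
      exact ⟨1, 0, fun S => by simp [sliceMonomial_apply, h]⟩
    · obtain ⟨i, rfl⟩ := Finset.card_eq_one.1 h
      exact ⟨0, fun j => if j = i then 1 else 0, fun S => by simp [sliceMonomial_apply]⟩
  | zero => exact ⟨0, 0, fun S => by simp⟩
  | add x y _ _ hx hy =>
    obtain ⟨c, a, h⟩ := hx
    obtain ⟨c', a', h'⟩ := hy
    refine ⟨c + c', a + a', fun S => ?_⟩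
    simp only [PiLp.add_apply, h, h', Pi.add_apply, Finset.sum_add_distrib]
    ring
  | smul r x _ hx =>
    obtain ⟨c, a, h⟩ := hx
    refine ⟨r * c, r • a, fun S => ?_⟩
    simp only [PiLp.smul_apply, h, Pi.smul_apply, smul_eq_mul, ← Finset.mul_sum]
    ring

/-! ### Boolean affine functions on the slice. -/

theorem exists_kSubset_between {n k : ℕ} (A B : Finset (Fin n)) (hAB : Disjoint A B)
    (hA : A.card ≤ k) (hB : k + B.card ≤ n) :
    ∃ S : KSubset n k, A ⊆ S.1 ∧ Disjoint S.1 B := by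
  obtain ⟨S, hAS, hSB, hS⟩ := Finset.exists_subsuperset_card_eq (s := A) (t := Bᶜ) (n := k)
    (Finset.subset_compl_iff_disjoint_right.2 hAB) hA (by
      rw [Finset.card_compl, Fintype.card_fin]
      omega)
  exact ⟨⟨S, hS⟩, hAS, Finset.subset_compl_iff_disjoint_right.1 hSB⟩

open Finset in
/-- Boolean affine functions on the slice are constants, coordinates or their negations. -/
theorem boolean_affine_slice {n k : ℕ} (hk : 2 ≤ k) (hkn : k + 2 ≤ n)
    (D : Finset (KSubset n k)) (c : ℝ) (a : Fin n → ℝ)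
    (h : ∀ S : KSubset n k, (if S ∈ D then (1 : ℝ) else 0) = c + ∑ i ∈ S.1, a i) :
    D = ∅ ∨ D = univ ∨ ∃ i, D = johnsonStar n k i ∨ D = (johnsonStar n k i)ᶜ := by
  have h01 : ∀ S : KSubset n k, c + ∑ i ∈ S.1, a i = 0 ∨ c + ∑ i ∈ S.1, a i = 1 := by
    intro S
    rw [← h S]
    split_ifs <;> simp
  have hD : ∀ S : KSubset n k, S ∈ D ↔ c + ∑ i ∈ S.1, a i = 1 := by
    intro S
    rw [← h S]
    split_ifs with hS <;> simp [hS]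
  by_cases hconst : ∀ i j, a i = a j
  · have i₀ : Fin n := ⟨0, by omega⟩
    have hsum : ∀ S : KSubset n k, ∑ i ∈ S.1, a i = k * a i₀ := by
      intro S
      rw [sum_congr rfl fun i _ => hconst i i₀, sum_const, S.2, nsmul_eq_mul]
    by_cases h1 : c + k * a i₀ = 1
    · exact Or.inr (Or.inl (by ext S; simp [hD, hsum, h1]))
    · exact Or.inl (by ext S; simp [hD, hsum, h1])
  right; right
  have hsw : ∀ (R : Finset (Fin n)), R.card + 1 = k → ∀ i ∉ R,
      c + (a i + ∑ x ∈ R, a x) = 0 ∨ c + (a i + ∑ x ∈ R, a x) = 1 := by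
    intro R hR i hi
    have := h01 ⟨insert i R, by rw [card_insert_of_notMem hi, hR]⟩
    rwa [sum_insert hi] at this
  obtain ⟨i, j, hlt⟩ : ∃ i j, a j < a i := by
    push Not at hconst
    obtain ⟨i, j, hij⟩ := hconst
    rcases lt_or_gt_of_ne hij with h | h
    · exact ⟨j, i, h⟩
    · exact ⟨i, j, h⟩
  have hij : i ≠ j := by
    rintro rfl
    exact lt_irrefl _ hlt
  -- Exchanging j for i strictly increases a value in {0, 1}, which fixes both values.
  have hR : ∀ (R : Finset (Fin n)), R.card + 1 = k → i ∉ R → j ∉ R →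
      c + (a i + ∑ x ∈ R, a x) = 1 ∧ c + (a j + ∑ x ∈ R, a x) = 0 := by
    intro R hR hi hj
    rcases hsw R hR i hi with h1 | h1 <;> rcases hsw R hR j hj with h2 | h2
    · linarith
    · linarith
    · exact ⟨h1, h2⟩
    · linarith
  have hother : ∀ m m', m ≠ i → m ≠ j → m' ≠ i → m' ≠ j → a m = a m' := by
    intro m m' hmi hmj hmi' hmj'
    rcases eq_or_ne m m' with rfl | hmm
    · rfl
    -- Q has k - 2 points and avoids up to four, which needs k + 2 ≤ n.
    obtain ⟨⟨Q, hQ⟩, -, hQd⟩ := exists_kSubset_between (k := k - 2) ∅ {i, j, m, m'} (by simp)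
      (by simp) (by
        have := card_le_four (a := i) (b := j) (c := m) (d := m')
        omega)
    simp only [disjoint_insert_right, disjoint_singleton_right] at hQd
    obtain ⟨hQi, hQj, hQm, hQm'⟩ := hQd
    have e1 := (hR (insert m Q) (by rw [card_insert_of_notMem hQm]; omega)
      (by simp [hQi, hmi.symm]) (by simp [hQj, hmj.symm])).1
    have e2 := (hR (insert m' Q) (by rw [card_insert_of_notMem hQm']; omega)
      (by simp [hQi, hmi'.symm]) (by simp [hQj, hmj'.symm])).1
    rw [sum_insert hQm] at e1
    rw [sum_insert hQm'] at e2
    linarith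
  obtain ⟨⟨S, hS⟩, -, hSd⟩ := exists_kSubset_between (k := k) ∅ {i, j} (by simp) (by simp)
    (by rw [card_pair hij]; omega)
  simp only [disjoint_insert_right, disjoint_singleton_right] at hSd
  obtain ⟨hSi, hSj⟩ := hSd
  obtain ⟨m, hm⟩ : S.Nonempty := card_pos.1 (by omega)
  have hmi : m ≠ i := fun h => hSi (h ▸ hm)
  have hmj : m ≠ j := fun h => hSj (h ▸ hm)
  have hb : ∀ x, x ≠ i → x ≠ j → a x = a m := fun x h1 h2 => hother x m h1 h2 hmi hmj
  have hsumS : ∑ x ∈ S.erase m, a x + a m = k * a m := by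
    rw [sum_erase_add _ _ hm, sum_congr rfl fun x hx =>
      hb x (fun h => hSi (h ▸ hx)) fun h => hSj (h ▸ hx), sum_const, hS, nsmul_eq_mul]
  obtain ⟨e1, e2⟩ := hR (S.erase m) (by rw [card_erase_add_one hm, hS])
    (fun h => hSi (mem_of_mem_erase h)) fun h => hSj (mem_of_mem_erase h)
  have e3 := h01 ⟨S, hS⟩
  rw [← sum_erase_add _ _ hm, hsumS] at e3
  have hsum : ∀ T : KSubset n k, ∑ x ∈ T.1, a x = k * a m +
      (if i ∈ T.1 then a i - a m else 0) + (if j ∈ T.1 then a j - a m else 0) := by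
    intro T
    have hx : ∀ x, a x = a m + (if i = x then a i - a m else 0) +
        (if j = x then a j - a m else 0) := by
      intro x
      by_cases h1 : i = x
      · subst h1
        simp [hij.symm]
      · by_cases h2 : j = x
        · subst h2
          simp [h1]
        · simp [h1, h2, hb x (Ne.symm h1) (Ne.symm h2)]
    rw [sum_congr rfl fun x _ => hx x, sum_add_distrib, sum_add_distrib, sum_const, T.2,
      sum_ite_eq, sum_ite_eq, nsmul_eq_mul]
  -- The value on a k-set avoiding i and j decides: 0 gives the star of i, 1 the complement of the
  -- star of j.
  rcases e3 with e3 | e3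
  · have h1 : a j = a m := by linarith
    have h2 : a i = a m + 1 := by linarith
    refine ⟨i, Or.inl ?_⟩
    ext T
    rw [hD, hsum, h1, h2]
    by_cases hi : i ∈ T.1
    · simp [johnsonStar, hi]
      linarith
    · simp [johnsonStar, hi]
      linarith
  · have h1 : a i = a m := by linarith
    have h2 : a j = a m - 1 := by linarith
    refine ⟨j, Or.inr ?_⟩
    ext T
    rw [hD, hsum, h1, h2]
    by_cases hj : j ∈ T.1
    · simp [johnsonStar, hj]
      linarith
    · simp [johnsonStar, hj]
      linarith

/-! ### Sums of eigenfunctions over stars. -/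

theorem inner_sliceMonomial {n k : ℕ} (A : Finset (Fin n))
    (φ : EuclideanSpace ℝ (KSubset n k)) :
    inner ℝ φ (sliceMonomial n k A) = ∑ S with A ⊆ S.1, φ S := by
  simp [PiLp.inner_apply, sliceMonomial_apply, Finset.sum_filter]

/-- Eigenfunctions for an eigenvalue other than `λ₀ = 0` sum to zero. -/
theorem sum_eq_zero_of_mem_eigenspace {n k : ℕ} {μ : ℝ} (hμ : μ ≠ 0)
    {φ : EuclideanSpace ℝ (KSubset n k)}
    (hφ : φ ∈ laplacianEigenspace (johnsonGraph n k) μ) : ∑ S, φ S = 0 := by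
  have h1 := johnsonLaplacian_isSymmetric n k φ (sliceMonomial n k ∅)
  rw [Module.End.mem_eigenspace_iff.1 hφ, johnsonLaplacian_sliceMonomial] at h1
  simp only [johnsonEigenvalue, Finset.card_empty, Nat.cast_zero, zero_mul, zero_smul,
    Finset.sum_empty, smul_zero, sub_zero, inner_zero_right, inner_smul_left,
    inner_sliceMonomial] at h1
  simpa [hμ] using h1

/-- Eigenfunctions for an eigenvalue other than `λ₀` and `λ₁` sum to zero over every star. -/
theorem sum_johnsonStar_eq_zero_of_mem_eigenspace {n k : ℕ} {μ : ℝ} (hμ : μ ≠ 0)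
    (hμn : μ ≠ n) {φ : EuclideanSpace ℝ (KSubset n k)}
    (hφ : φ ∈ laplacianEigenspace (johnsonGraph n k) μ) (i : Fin n) :
    ∑ S ∈ johnsonStar n k i, φ S = 0 := by
  have h0 := sum_eq_zero_of_mem_eigenspace hμ hφ
  -- L x_{i} = n x_{i} - k x_∅, and φ is orthogonal to x_∅.
  have h1 := johnsonLaplacian_isSymmetric n k φ (sliceMonomial n k {i})
  rw [Module.End.mem_eigenspace_iff.1 hφ, johnsonLaplacian_sliceMonomial] at h1
  have h2 : (inner ℝ φ (sliceMonomial n k ∅) : ℝ) = 0 := by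
    rw [inner_sliceMonomial]
    simpa using h0
  have h3 : (inner ℝ φ (sliceMonomial n k {i}) : ℝ) = ∑ S ∈ johnsonStar n k i, φ S := by
    rw [inner_sliceMonomial]
    simp [johnsonStar]
  simp only [johnsonEigenvalue, Finset.card_singleton, Nat.cast_one, one_mul,
    Finset.sum_singleton, Finset.erase_singleton, inner_sub_right, inner_smul_right, h2, h3,
    inner_smul_left, mul_zero, sub_zero, add_sub_cancel_right, conj_trivial] at h1
  have h4 : (μ - n) * ∑ S ∈ johnsonStar n k i, φ S = 0 := by linarith
  exact (mul_eq_zero.1 h4).resolve_left (sub_ne_zero.2 hμn)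

/-- λ_t - n = (t - 1)(n - t); this separates λ_t from λ_0 = 0 and λ_1 = n. -/
theorem johnsonEigenvalue_gt {n t : ℕ} (ht : 2 ≤ t) (htn : t < n) :
    (n : ℝ) < johnsonEigenvalue n t := by
  have h1 : (2 : ℝ) ≤ t := by exact_mod_cast ht
  have h2 : (t : ℝ) < n := by exact_mod_cast htn
  have : 0 < ((t : ℝ) - 1) * (n - t) := mul_pos (by linarith) (by linarith)
  unfold johnsonEigenvalue
  linarith

/-! ### Classification of designs and minimal designs. -/

/-- The eigenfunctions have mean zero, so averaging means a vanishing sum over D. That condition is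
linear, so the choice of basis is immaterial. -/
theorem isDesign_iff_sum_eq_zero {n k : ℕ} (hkn : k < n)
    {Φ : ℕ → Set (EuclideanSpace ℝ (KSubset n k))}
    (hΦ : ∀ t ∈ Finset.Icc 1 k, IsOrthonormalBasisOf (Φ t)
      (laplacianEigenspace (johnsonGraph n k) (johnsonEigenvalue n t)))
    (D : Finset (KSubset n k)) :
    IsDesign (unionOver Φ (Finset.Icc 1 k \ Finset.Icc 1 1)) D ↔
      D.Nonempty ∧ ∀ t ∈ Set.Icc 2 k,
        ∀ φ ∈ laplacianEigenspace (johnsonGraph n k) (johnsonEigenvalue n t),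
          ∑ S ∈ D, φ S = 0 := by
  refine and_congr_right fun hne => ?_
  have hcard : (1 / (D.card : ℝ)) ≠ 0 := by
    have := hne.card_pos
    positivity
  have hav : ∀ t ∈ Set.Icc 2 k,
      ∀ φ ∈ laplacianEigenspace (johnsonGraph n k) (johnsonEigenvalue n t),
      (Averages D φ ↔ ∑ S ∈ D, φ S = 0) := by
    intro t ht φ hφ
    have hpos : (0 : ℝ) < johnsonEigenvalue n t :=
      (Nat.cast_nonneg n).trans_lt (johnsonEigenvalue_gt ht.1 (ht.2.trans_lt hkn))
    rw [Averages, sum_eq_zero_of_mem_eigenspace hpos.ne' hφ, mul_zero, mul_eq_zero,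
      or_iff_right hcard]
  have hmemI : ∀ t, t ∈ Finset.Icc 1 k \ Finset.Icc 1 1 ↔ t ∈ Set.Icc 2 k := by
    intro t
    simp only [Finset.mem_sdiff, Finset.mem_Icc, Set.mem_Icc]
    omega
  have hspan : ∀ t ∈ Set.Icc 2 k, Submodule.span ℝ (Φ t) =
      laplacianEigenspace (johnsonGraph n k) (johnsonEigenvalue n t) := fun t ht =>
    (hΦ t (Finset.mem_Icc.2 ⟨one_le_two.trans ht.1, ht.2⟩)).2
  simp only [unionOver, Set.mem_iUnion, hmemI]
  constructor
  · intro h t ht φ hφ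
    have hφ' := hφ
    rw [← hspan t ht] at hφ'
    induction hφ' using Submodule.span_induction with
    | mem x hx =>
      refine (hav t ht x ?_).1 (h x ⟨t, ht, hx⟩)
      rw [← hspan t ht]
      exact Submodule.subset_span hx
    | zero => simp
    | add x y hx hy ihx ihy =>
      rw [hspan t ht] at hx hy
      simp [Finset.sum_add_distrib, ihx hx, ihy hy]
    | smul r x hx ihx =>
      rw [hspan t ht] at hx
      simp [← Finset.mul_sum, ihx hx]
  · rintro h φ ⟨t, ht, hφ⟩
    have hφ' : φ ∈ laplacianEigenspace (johnsonGraph n k) (johnsonEigenvalue n t) := by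
      rw [← hspan t ht]
      exact Submodule.subset_span hφ
    exact (hav t ht φ hφ').2 (h t ht φ hφ')

theorem mem_johnsonStar {n k : ℕ} {i : Fin n} {S : KSubset n k} :
    S ∈ johnsonStar n k i ↔ i ∈ S.1 := by
  simp [johnsonStar]

theorem johnsonStar_nonempty {n k : ℕ} (hk : 1 ≤ k) (hkn : k ≤ n) (i : Fin n) :
    (johnsonStar n k i).Nonempty := by
  obtain ⟨S, hS, -⟩ := exists_kSubset_between (k := k) {i} ∅ (by simp) (by simpa) (by simpa)
  exact ⟨S, mem_johnsonStar.2 (hS (by simp))⟩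

theorem compl_johnsonStar_nonempty {n k : ℕ} (hkn : k < n) (i : Fin n) :
    (johnsonStar n k i)ᶜ.Nonempty := by
  obtain ⟨S, -, hS⟩ := exists_kSubset_between (k := k) ∅ {i} (by simp) (by simp) (by simpa)
  exact ⟨S, by simpa [mem_johnsonStar] using hS⟩

/-- The designs are the whole vertex set, the stars and their complements. -/
theorem isDesign_iff_johnsonStar {n k : ℕ} (hk : 2 ≤ k) (hkn : k + 2 ≤ n)
    {Φ : ℕ → Set (EuclideanSpace ℝ (KSubset n k))}
    (hΦ : ∀ t ∈ Finset.Icc 1 k, IsOrthonormalBasisOf (Φ t)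
      (laplacianEigenspace (johnsonGraph n k) (johnsonEigenvalue n t)))
    (D : Finset (KSubset n k)) :
    IsDesign (unionOver Φ (Finset.Icc 1 k \ Finset.Icc 1 1)) D ↔
      D = Finset.univ ∨ ∃ i, D = johnsonStar n k i ∨ D = (johnsonStar n k i)ᶜ := by
  rw [isDesign_iff_sum_eq_zero (by omega) hΦ]
  constructor
  · rintro ⟨hne, h⟩
    have hf : (WithLp.toLp 2 fun S => if S ∈ D then (1 : ℝ) else 0) ∈
        (⨆ t ∈ Set.Icc 2 k,
          Module.End.eigenspace (johnsonLaplacian n k) (johnsonEigenvalue n t))ᗮ := by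
      refine mem_orthogonal_biSup_iff.2 fun t ht φ hφ => ?_
      refine Eq.trans ?_ (h t ht φ hφ)
      simp [PiLp.inner_apply]
    obtain ⟨c, a, hca⟩ :=
      exists_affine_of_mem_sliceDegreeLE_one (mem_sliceDegreeLE_one (by omega) hf)
    exact (boolean_affine_slice hk hkn D c a hca).resolve_left hne.ne_empty
  · have hgt : ∀ t ∈ Set.Icc 2 k, (n : ℝ) < johnsonEigenvalue n t := fun t ht =>
      johnsonEigenvalue_gt ht.1 (by have := ht.2; omega)
    have h0 : ∀ t ∈ Set.Icc 2 k, johnsonEigenvalue n t ≠ 0 := fun t ht =>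
      ((Nat.cast_nonneg n).trans_lt (hgt t ht)).ne'
    have hn : 0 < n := by omega
    rintro (rfl | ⟨i, rfl | rfl⟩)
    · exact ⟨(johnsonStar_nonempty (by omega) (by omega) ⟨0, hn⟩).mono (Finset.subset_univ _),
        fun t ht φ hφ => sum_eq_zero_of_mem_eigenspace (h0 t ht) hφ⟩
    · exact ⟨johnsonStar_nonempty (by omega) (by omega) i, fun t ht φ hφ =>
        sum_johnsonStar_eq_zero_of_mem_eigenspace (h0 t ht) (hgt t ht).ne' hφ i⟩
    · refine ⟨compl_johnsonStar_nonempty (by omega) i, fun t ht φ hφ => ?_⟩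
      have h1 := Finset.sum_add_sum_compl (johnsonStar n k i) fun S => φ S
      rwa [sum_johnsonStar_eq_zero_of_mem_eigenspace (h0 t ht) (hgt t ht).ne' hφ i, zero_add,
        sum_eq_zero_of_mem_eigenspace (h0 t ht) hφ] at h1

theorem eq_of_johnsonStar_subset {n k : ℕ} (hk : 1 ≤ k) (hkn : k + 1 ≤ n) {i j : Fin n}
    (h : johnsonStar n k j ⊆ johnsonStar n k i) : j = i := by
  by_contra hij
  obtain ⟨S, h1, h2⟩ := exists_kSubset_between (k := k) {j} {i} (by simpa using hij) (by simpa)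
    (by simpa)
  have h3 := mem_johnsonStar.1 (h (mem_johnsonStar.2 (h1 (Finset.mem_singleton_self j))))
  exact Finset.disjoint_singleton_right.1 h2 h3

theorem mainTheorem12 (n k : ℕ) (hk : 2 ≤ k) (hkn : 2 * k ≤ n)
    (Φ : ℕ → Set (EuclideanSpace ℝ (KSubset n k)))
    (hΦ : ∀ t ∈ Finset.Icc 1 k, IsOrthonormalBasisOf (Φ t)
      (laplacianEigenspace (johnsonGraph n k) (johnsonEigenvalue n t))) :
    (∀ D : Finset (KSubset n k),
      IsMinimalDesign (unionOver Φ (Finset.Icc 1 k \ Finset.Icc 1 1)) D ↔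
        ∃ i : Fin n, D = johnsonStar n k i ∨ D = (johnsonStar n k i)ᶜ) ∧
    (∀ D : Finset (KSubset n k),
      IsDesign (unionOver Φ (Finset.Icc 1 k \ Finset.Icc 1 1)) D →
        ∃ F : Finset (Finset (KSubset n k)),
          (∀ E ∈ F, ∃ i : Fin n, E = johnsonStar n k i ∨ E = (johnsonStar n k i)ᶜ) ∧
          D = F.biUnion id) := by
  have hn : 0 < n := by omega
  have hdes := isDesign_iff_johnsonStar hk (by omega) hΦ
  have hstar : ∀ i, johnsonStar n k i ≠ Finset.univ := fun i h => by
    simpa [h] using compl_johnsonStar_nonempty (k := k) (by omega) i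
  have hcompl : ∀ i, (johnsonStar n k i)ᶜ ≠ Finset.univ := fun i h => by
    have := johnsonStar_nonempty (k := k) (by omega) (by omega) i
    rw [Finset.compl_eq_univ_iff] at h
    simp [h] at this
  refine ⟨fun D => ⟨?_, ?_⟩, fun D hD => ?_⟩
  · rintro ⟨hD, hmin⟩
    rcases (hdes D).1 hD with rfl | h
    · exact absurd (hmin _ ((hdes _).2 (Or.inr ⟨⟨0, hn⟩, Or.inl rfl⟩)) (Finset.subset_univ _))
        (hstar _)
    · exact h
  · intro h
    refine ⟨(hdes D).2 (Or.inr h), fun D' hD' hsub => ?_⟩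
    obtain ⟨i, rfl | rfl⟩ := h
    · rcases (hdes D').1 hD' with rfl | ⟨j, rfl | rfl⟩
      · exact absurd (Finset.univ_subset_iff.1 hsub) (hstar i)
      · rw [eq_of_johnsonStar_subset (by omega) (by omega) hsub]
      -- A k-set avoiding both i and j lies in the complement of one star but not in the other star.
      · obtain ⟨S, -, h2⟩ := exists_kSubset_between (k := k) ∅ {i, j} (by simp) (by simp) (by
          have := Finset.card_le_two (a := i) (b := j)
          omega)
        simp only [Finset.disjoint_insert_right, Finset.disjoint_singleton_right] at h2
        exact absurd (mem_johnsonStar.1 (hsub (Finset.mem_compl.2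
          (mt mem_johnsonStar.1 h2.2)))) h2.1
    · rcases (hdes D').1 hD' with rfl | ⟨j, rfl | rfl⟩
      · exact absurd (Finset.univ_subset_iff.1 hsub) (hcompl i)
      -- Since k ≥ 2, some k-set contains both i and j, so the two stars meet.
      · obtain ⟨S, h1, -⟩ := exists_kSubset_between (k := k) {i, j} ∅ (by simp)
          (Finset.card_le_two.trans hk) (by simp; omega)
        have h2 := hsub (mem_johnsonStar.2 (h1 (by simp : j ∈ ({i, j} : Finset (Fin n)))))
        exact absurd (mem_johnsonStar.2 (h1 (by simp))) (Finset.mem_compl.1 h2)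
      · rw [eq_of_johnsonStar_subset (by omega) (by omega) (Finset.compl_subset_compl.1 hsub)]
  · rcases (hdes D).1 hD with rfl | h
    · refine ⟨{johnsonStar n k ⟨0, hn⟩, (johnsonStar n k ⟨0, hn⟩)ᶜ}, ?_, ?_⟩
      · intro E hE
        exact ⟨⟨0, hn⟩, by simpa using hE⟩
      · simp [Finset.biUnion_insert]
    · exact ⟨{D}, fun E hE => by rwa [Finset.mem_singleton.1 hE], by simp⟩
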